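/- Let $k \ge 1$ and $n \ge k+1$. An instance of $k$-Facility Location on the line is a pair $(\vec x, c)$ with $\vec x = (x_1,\dots,x_n) \in \mathbb R^n$ the agents' locations and $c : \mathbb R_{\ge 0} \to \mathbb R_{\ge 0}$ a cost function with $c(0)=0$; throughout, $c$ is concave and continuous. For facilities $\vec y \in \mathbb R^k$, an agent at $a$ has cost $\mathrm{cost}(a,\vec y) = c(\min_{1\le j\le k}|a-y_j|)$; for a probability distribution $P$ over $\mathbb R^k$, $\mathrm{cost}(a,P) = \mathbb E_{\vec y\sim P}[\mathrm{cost}(a,\vec y)]$. Put $MC^*(\vec x,c)=\min_{\vec y\in\mathbb R^k}\max_i \mathrm{cost}(x_i,\vec y)$ and $SC^*(\vec x,c)=\min_{\vec y\in\mathbb R^k}\sum_i \mathrm{cost}(x_i,\vec y)$. A randomized mechanism maps each instance to a probability distribution over $\mathbb R^k$. The Equal Cost mechanism $EC$ proceeds on $(\vec x,c)$ as follows. 1. It takes a covering of all agent locations by $k$ pairwise disjoint intervals $[\alpha_j,\alpha_j+\ell]$, $\alpha_1<\dots<\alpha_k$, of minimum length $\ell\ge 0$. 2. It takes a random variable $X$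 with values in $[0,\ell]$ such that $\mathbb E[c(|a-X|)]$ is the same for all $a\in[0,\ell]$. 3. It places, with the same $X$ for all intervals, a facility at $\alpha_j+X$ for each odd $j$ and at $\alpha_j+\ell-X$ for each even $j$. Then the mechanism can be carried out on every such instance (a covering of minimum length $\ell$ and a random variable $X$ as required always exist), and, for every choice of the coverings and of the random variables $X$, the following hold. - $EC$ is group strategyproof: for every $c$, every profile $\vec x$, every non-empty coalition $S$ and every profile $\vec x'$ with $x'_i=x_i$ for all $i\notin S$, there is $i\in S$ with $\mathrm{cost}(x_i,EC(\vec x,c))\le \mathrm{cost}(x_i,EC(\vec x',c))$. - $EC$ is $2$-approximate for Max Cost: $\mathbb E_{\vec y\sim EC(\vec x,c)}[\max_i \mathrm{cost}(x_i,\vec y)]\le 2\,MC^*(\vec x,c)$ for all $(\vec x,c)$. - $EC$ is $n$-approximate for Social Cost: $\sum_i \mathrm{cost}(x_i,EC(\vec x,c))\le n\,SC^*(\vec x,c)$ for all $(\vec x,c)$. - For every instance $(\vec x,c)$ and every agent $i$, $\mathrm{cost}(x_i,EC(\vec x,c))\le MC^*(\vec x,c)=c(\ell/2)$. -/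

import Mathlib

open MeasureTheory Set

noncomputable section

namespace FacilityLocation

/-- A cost function is represented by a map `ℝ → ℝ` of which only the values at distances `d ≥ 0`
are ever used. It is non-negative there, normalized by `c 0 = 0`, concave and continuous
(for concave functions this only excludes a jump at `0`). -/
structure IsConcaveCost (c : ℝ → ℝ) : Prop where
  map_zero : c 0 = 0
  nonneg : ∀ d, 0 ≤ d → 0 ≤ c d
  concave : ConcaveOn ℝ (Ici 0) c
  continuous : ContinuousOn c (Ici 0)

/-- The class of all (continuous) concave cost functions. -/
def concaveCosts : Set (ℝ → ℝ) := {c | IsConcaveCost c}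

/-- A randomized mechanism maps an instance `(x, c)` with `n` agents to a probability distribution
over `k`-tuples of facility locations. -/
abbrev Mechanism (k n : ℕ) : Type :=
  (Fin n → ℝ) → (ℝ → ℝ) → ProbabilityMeasure (Fin k → ℝ)

variable {k n : ℕ}

/-- Connection cost `c (min_j |a - y_j|)` of an agent at `a` for the facilities `y`. -/
def cost (c : ℝ → ℝ) (a : ℝ) (y : Fin k → ℝ) : ℝ := c (⨅ j, |a - y j|)

/-- Expected connection cost of an agent at `a` for random facilities. -/
def expCost (c : ℝ → ℝ) (a : ℝ) (P : ProbabilityMeasure (Fin k → ℝ)) : ℝ :=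
  ∫ y, cost c a y ∂(P : Measure (Fin k → ℝ))

/-- Maximum connection cost of the agents for the facilities `y`. -/
def maxCost (c : ℝ → ℝ) (x : Fin n → ℝ) (y : Fin k → ℝ) : ℝ := ⨆ i, cost c (x i) y

/-- Expected maximum cost. -/
def expMaxCost (c : ℝ → ℝ) (x : Fin n → ℝ) (P : ProbabilityMeasure (Fin k → ℝ)) : ℝ :=
  ∫ y, maxCost c x y ∂(P : Measure (Fin k → ℝ))

/-- Optimal maximum cost with `k` facilities. -/
def optMaxCost (k : ℕ) (c : ℝ → ℝ) (x : Fin n → ℝ) : ℝ := ⨅ y : Fin k → ℝ, maxCost c x y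

/-- Expected social cost. -/
def expSocialCost (c : ℝ → ℝ) (x : Fin n → ℝ) (P : ProbabilityMeasure (Fin k → ℝ)) : ℝ :=
  ∑ i, expCost c (x i) P

/-- Optimal social cost with `k` facilities. -/
def optSocialCost (k : ℕ) (c : ℝ → ℝ) (x : Fin n → ℝ) : ℝ :=
  ⨅ y : Fin k → ℝ, ∑ i, cost c (x i) y

/-- Approximation ratio `ρ` for the maximum cost, on a class `C` of cost functions. -/
def HasMaxCostRatio (C : Set (ℝ → ℝ)) (F : Mechanism k n) (ρ : ℝ) : Prop :=
  ∀ c ∈ C, ∀ x : Fin n → ℝ, expMaxCost c x (F x c) ≤ ρ * optMaxCost k c x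

/-- Approximation ratio `ρ` for the social cost, on a class `C` of cost functions. -/
def HasSocialCostRatio (C : Set (ℝ → ℝ)) (F : Mechanism k n) (ρ : ℝ) : Prop :=
  ∀ c ∈ C, ∀ x : Fin n → ℝ, expSocialCost c x (F x c) ≤ ρ * optSocialCost k c x

/-- (Weak) group strategyproofness: whenever the agents of a non-empty coalition `S` change their
reports, turning the true profile `x` into `x'`, some agent of `S` does not benefit. -/
def GroupStrategyproof (C : Set (ℝ → ℝ)) (F : Mechanism k n) : Prop :=
  ∀ c ∈ C, ∀ x : Fin n → ℝ, ∀ S : Finset (Fin n), S.Nonempty →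
    ∀ x' : Fin n → ℝ, (∀ i, i ∉ S → x' i = x i) →
      ∃ i ∈ S, expCost c (x i) (F x c) ≤ expCost c (x i) (F x' c)

/-- The intervals `[α j, α j + ℓ]`, numbered from left to right, are pairwise disjoint and cover
all agent locations. -/
structure IsCovering (x : Fin n → ℝ) (ℓ : ℝ) (α : Fin k → ℝ) : Prop where
  length_nonneg : 0 ≤ ℓ
  strictMono : StrictMono α
  disjoint : Pairwise fun i j => Disjoint (Icc (α i) (α i + ℓ)) (Icc (α j) (α j + ℓ))
  covers : ∀ i, ∃ j, x i ∈ Icc (α j) (α j + ℓ)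

/-- `ℓ` is the minimum length for which `k` disjoint intervals of length `ℓ` cover the agents. -/
def IsMinLength (k : ℕ) (x : Fin n → ℝ) (ℓ : ℝ) : Prop :=
  IsLeast {l : ℝ | ∃ α : Fin k → ℝ, IsCovering x l α} ℓ

/-- `μ` is the law of a random variable `X` with values in `[0, ℓ]` for which all locations
`a ∈ [0, ℓ]` have the same expected connection cost `E[c(|a - X|)]`. -/
structure IsEqualizing (c : ℝ → ℝ) (ℓ : ℝ) (μ : ProbabilityMeasure ℝ) : Prop where
  support : (μ : Measure ℝ) (Icc 0 ℓ)ᶜ = 0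
  equal : ∀ a ∈ Icc 0 ℓ, ∀ b ∈ Icc 0 ℓ,
    ∫ t, c |a - t| ∂(μ : Measure ℝ) = ∫ t, c |b - t| ∂(μ : Measure ℝ)

/-- The facilities for the sample `t` of `X`: at `α j + t` in the 1st, 3rd, 5th, ... interval and,
reflected, at `α j + ℓ - t` in the 2nd, 4th, ... interval (`Fin k` counts from `0`). -/
def placement (ℓ : ℝ) (α : Fin k → ℝ) (t : ℝ) : Fin k → ℝ :=
  fun j => if Even (j : ℕ) then α j + t else α j + ℓ - t

/-- `F` is an Equal Cost mechanism: on every instance with a concave cost function it takes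
an optimal covering, an equalizing random variable `X`, and outputs the facilities placed
according to `X` with reflection in every other interval. -/
def IsEqualCost (F : Mechanism k n) : Prop :=
  ∀ c ∈ concaveCosts, ∀ x : Fin n → ℝ,
    ∃ (ℓ : ℝ) (α : Fin k → ℝ) (μ : ProbabilityMeasure ℝ),
      IsMinLength k x ℓ ∧ IsCovering x ℓ α ∧ IsEqualizing c ℓ μ ∧
        (F x c : Measure (Fin k → ℝ)) = (μ : Measure ℝ).map (placement ℓ α)

end FacilityLocation

end

/-!
A probability measure `μ` on `[0, ℓ]` that maximizes the energy `∬ c |s - t| dμ(s) dμ(t)` has a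
potential that is `μ`-almost everywhere equal to its maximum. On a gap of the support of `μ` the
potential is concave, hence not below its values at the ends of the gap; so it is constant, and `μ`
is equalizing.

Because every other interval is reflected, the boundary between the regions served by two
consecutive facilities does not move with the sample. So each location is served from a fixed
interval and pays the potential of `μ` at its coordinate there, which for an agent inside a covering
interval is the equalized cost, at most `c (ℓ / 2)`.

For group strategyproofness, let `μ` be the measure used after a misreport and `ν` the one used for
the true locations, with minimum length `ℓ`. The true coordinates in the intervals that serve the
agents after the misreport have a minimum `lo` and a maximum `hi` with `hi - lo ≥ ℓ`. Averaging the
potential of `μ` over `lo + t` with `t` distributed as `ν` gives, by Fubini, an average of the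
potential of `ν`, which is never below the equalized cost. But the potential of `μ` on `[lo, hi]` is
largest at an end, so one of the two extreme agents pays at least the equalized cost.
-/

noncomputable section

namespace FacilityLocation

section Concave

theorem nonpos_of_forall_add_mul_nonpos {A B : ℝ} (h : ∀ p ∈ Ioc (0 : ℝ) 1, A + p * B ≤ 0) :
    A ≤ 0 := by
  have hclosed : IsClosed {p : ℝ | A + p * B ≤ 0} := isClosed_le (by fun_prop) continuous_const
  have hzero : (0 : ℝ) ∈ closure (Ioc 0 1) := by
    rw [closure_Ioc zero_ne_one]
    exact left_mem_Icc.2 zero_le_one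
  have h0 : A + 0 * B ≤ 0 := closure_minimal h hclosed hzero
  simpa using h0

theorem monotoneOn_Ici_of_concaveOn_of_bddBelow {f : ℝ → ℝ} {a : ℝ}
    (hf : ConcaveOn ℝ (Ici a) f) (hb : BddBelow (f '' Ici a)) : MonotoneOn f (Ici a) := by
  obtain ⟨M, hM⟩ := hb
  intro x hx y _ hxy
  refine sub_nonpos.1 (nonpos_of_forall_add_mul_nonpos (B := M - f x) fun p ⟨hp0, hp1⟩ => ?_)
  -- `y` divides the segment from `x` to a far away point `z` in the ratio `p : 1 - p`.
  let z := x + (y - x) / p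
  have hz : z ∈ Ici a :=
    mem_Ici.2 (hx.trans (le_add_of_nonneg_right (div_nonneg (sub_nonneg.2 hxy) hp0.le)))
  have hy : (1 - p) • x + p • z = y := by
    simp only [z, smul_eq_mul]
    field_simp
    ring
  have hconc : (1 - p) * f x + p * f z ≤ f y := by
    have h := hf.2 hx hz (sub_nonneg.2 hp1) hp0.le (sub_add_cancel 1 p)
    rwa [hy] at h
  have hMz : p * M ≤ p * f z := mul_le_mul_of_nonneg_left (hM (mem_image_of_mem f hz)) hp0.le
  linarith

end Concave

section Potential

variable {X : Type*} [TopologicalSpace X] [MeasurableSpace X]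

theorem integrable_of_ae_mem_isCompact [OpensMeasurableSpace X] [T2Space X] {μ : Measure X}
    [IsFiniteMeasureOnCompacts μ] {K : Set X} (hK : IsCompact K) (hμ : ∀ᵐ t ∂μ, t ∈ K) {f : X → ℝ}
    (hf : Continuous f) : Integrable f μ := by
  rw [← Measure.restrict_eq_self_of_ae_mem hμ]
  exact hf.continuousOn.integrableOn_compact hK

/-- The potential `a ↦ ∫ g(a, t) dμ(t)` of the measure `μ` for the kernel `g`. -/
def potential (g : X → X → ℝ) (μ : Measure X) (a : X) : ℝ := ∫ t, g a t ∂μ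

/-- The energy `∬ g(s, t) dμ(s) dμ(t)` of the measure `μ` for the kernel `g`. Equalizing measures
are found by maximizing it. -/
def energy (g : X → X → ℝ) (μ : Measure X) : ℝ := ∫ a, potential g μ a ∂μ

variable {g : X → X → ℝ}

theorem continuous_potential [OpensMeasurableSpace X] [FirstCountableTopology X]
    [LocallyCompactSpace X] [SecondCountableTopologyEither X ℝ] {μ : Measure X}
    [IsLocallyFiniteMeasure μ] (hg : Continuous (Function.uncurry g)) {K : Set X}
    (hK : IsCompact K) (hμ : ∀ᵐ t ∂μ, t ∈ K) : Continuous (potential g μ) := by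
  have h := continuous_parametric_integral_of_continuous (μ := μ) hg hK
  rwa [Measure.restrict_eq_self_of_ae_mem hμ] at h

variable [CompactSpace X] [T2Space X] [BorelSpace X]

theorem integrable_of_continuous {μ : Measure X} [IsFiniteMeasure μ] {f : X → ℝ}
    (hf : Continuous f) : Integrable f μ :=
  integrable_of_ae_mem_isCompact isCompact_univ (Filter.Eventually.of_forall mem_univ) hf

open unitInterval in
theorem integral_dirac_mix {μ : Measure X} [IsFiniteMeasure μ] (a : X) (p : I) {f : X → ℝ}
    (hf : Continuous f) :
    ∫ t, f t ∂(toNNReal p • Measure.dirac a + toNNReal (σ p) • μ) =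
      p * f a + (1 - p) * ∫ t, f t ∂μ := by
  rw [integral_add_measure (integrable_of_continuous hf) (integrable_of_continuous hf),
    integral_smul_nnreal_measure, integral_smul_nnreal_measure, integral_dirac]
  simp [NNReal.smul_def]

variable [SecondCountableTopology X]

theorem continuous_potential_of_compactSpace {μ : Measure X} [IsFiniteMeasure μ]
    (hg : Continuous (Function.uncurry g)) : Continuous (potential g μ) :=
  continuous_potential hg isCompact_univ (Filter.Eventually.of_forall mem_univ)

theorem continuous_energy (hg : Continuous (Function.uncurry g)) :
    Continuous fun μ : ProbabilityMeasure X => energy g μ := by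
  have henergy : ∀ μ : ProbabilityMeasure X,
      energy g μ = ∫ p, Function.uncurry g p ∂(μ.prod μ : ProbabilityMeasure (X × X)) :=
    fun μ => (integral_prod _ (integrable_of_continuous hg)).symm
  simp only [henergy]
  exact (ProbabilityMeasure.continuous_integral_continuousMap (⟨_, hg⟩ : C(X × X, ℝ))).comp
    (by fun_prop : Continuous fun μ : ProbabilityMeasure X => μ.prod μ)

theorem exists_forall_energy_le [Nonempty X] (hg : Continuous (Function.uncurry g)) :
    ∃ μ : ProbabilityMeasure X, ∀ ν : ProbabilityMeasure X, energy g ν ≤ energy g μ := by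
  have : Nonempty (ProbabilityMeasure X) :=
    ‹Nonempty X›.map fun a => ⟨Measure.dirac a, inferInstance⟩
  obtain ⟨μ, -, hμ⟩ := isCompact_univ.exists_isMaxOn univ_nonempty
    (continuous_energy hg).continuousOn
  exact ⟨μ, fun ν => hμ (mem_univ ν)⟩

open unitInterval in
theorem energy_dirac_mix {μ : Measure X} [IsFiniteMeasure μ] (hg : Continuous (Function.uncurry g))
    (hsymm : ∀ s t, g s t = g t s) (a : X) (p : I) :
    energy g (toNNReal p • Measure.dirac a + toNNReal (σ p) • μ) =
      p ^ 2 * g a a + 2 * p * (1 - p) * potential g μ a + (1 - p) ^ 2 * energy g μ := by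
  have hpot : ∀ s, potential g (toNNReal p • Measure.dirac a + toNNReal (σ p) • μ) s =
      p * g a s + (1 - p) * potential g μ s := fun s => by
    have hgs : Continuous (g s) := hg.comp (Continuous.prodMk_right s)
    rw [potential, integral_dirac_mix a p hgs, hsymm, potential]
  have hga : Continuous (g a) := hg.comp (Continuous.prodMk_right a)
  have hU : Continuous (potential g μ) := continuous_potential_of_compactSpace hg
  have hint : ∫ s, (p * g a s + (1 - p) * potential g μ s) ∂μ =
      p * potential g μ a + (1 - p) * energy g μ := by
    rw [integral_add ((integrable_of_continuous hga).const_mul _)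
      ((integrable_of_continuous hU).const_mul _), integral_const_mul, integral_const_mul]
    rfl
  simp only [energy, hpot]
  rw [integral_dirac_mix a p (by fun_prop), hint, energy]
  ring

open unitInterval in
theorem potential_le_energy {μ : ProbabilityMeasure X} (hg : Continuous (Function.uncurry g))
    (hsymm : ∀ s t, g s t = g t s) (hμ : ∀ ν : ProbabilityMeasure X, energy g ν ≤ energy g μ)
    (a : X) : potential g μ a ≤ energy g μ := by
  suffices 2 * (potential g μ a - energy g μ) ≤ 0 by linarith
  -- First order condition at `p = 0` for the energy of `p δ_a + (1 - p) μ`.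
  refine nonpos_of_forall_add_mul_nonpos
    (B := g a a - 2 * potential g μ a + energy g μ) fun p hp => ?_
  let q : I := ⟨p, hp.1.le, hp.2⟩
  have hmax : energy g (toNNReal q • Measure.dirac a + toNNReal (σ q) • μ) ≤ energy g μ :=
    hμ ⟨_, inferInstance⟩
  rw [energy_dirac_mix hg hsymm] at hmax
  refine nonpos_of_mul_nonpos_right ?_ hp.1
  linarith

theorem ae_potential_eq_energy {μ : ProbabilityMeasure X} (hg : Continuous (Function.uncurry g))
    (hμ : ∀ a, potential g μ a ≤ energy g μ) :
    ∀ᵐ a ∂(μ : Measure X), potential g μ a = energy g μ := by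
  have hint : Integrable (potential g μ) (μ : Measure X) :=
    integrable_of_continuous (continuous_potential_of_compactSpace hg)
  have hzero : ∫ a, (energy g μ - potential g μ a) ∂(μ : Measure X) = 0 := by
    rw [integral_sub (integrable_const _) hint, ← energy]
    simp
  rw [integral_eq_zero_iff_of_nonneg (fun a => sub_nonneg.2 (hμ a))
    ((integrable_const _).sub hint)] at hzero
  filter_upwards [hzero] with a ha using (sub_eq_zero.1 ha).symm

end Potential

theorem exists_potential_le_and_ae_eq {X : Type*} [TopologicalSpace X] [T2Space X]
    [SecondCountableTopology X] [MeasurableSpace X] [BorelSpace X] {g : X → X → ℝ}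
    (hg : Continuous (Function.uncurry g)) (hsymm : ∀ s t, g s t = g t s) {K : Set X}
    (hK : IsCompact K) (hne : K.Nonempty) :
    ∃ (μ : ProbabilityMeasure X) (E : ℝ), (∀ᵐ a ∂(μ : Measure X), a ∈ K) ∧
      (∀ a ∈ K, potential g μ a ≤ E) ∧ ∀ᵐ a ∂(μ : Measure X), potential g μ a = E := by
  have : CompactSpace K := isCompact_iff_compactSpace.1 hK
  have : Nonempty K := hne.to_subtype
  let gK : K → K → ℝ := fun s t => g s t
  have hgK : Continuous (Function.uncurry gK) :=
    hg.comp (continuous_subtype_val.prodMap continuous_subtype_val)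
  obtain ⟨μK, hmax⟩ := exists_forall_energy_le hgK
  have hle := potential_le_energy hgK (fun s t => hsymm s t) hmax
  have hval : MeasurableEmbedding (Subtype.val : K → X) :=
    MeasurableEmbedding.subtype_coe hK.measurableSet
  let μ : ProbabilityMeasure X := μK.map hval.measurable.aemeasurable
  have hpot : ∀ a : K, potential g μ a = potential gK μK a := fun a => hval.integral_map _
  refine ⟨μ, energy gK μK, ?_, fun a ha => (hpot ⟨a, ha⟩).trans_le (hle _), ?_⟩
  · exact hval.ae_map_iff.2 (Filter.Eventually.of_forall Subtype.prop)
  · refine hval.ae_map_iff.2 ?_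
    filter_upwards [ae_potential_eq_energy hgK hle] with a ha using (hpot a).trans ha

section Integral

variable {X : Type*} [MeasurableSpace X] {μ : Measure X} [IsProbabilityMeasure μ] {f : X → ℝ}
  {M : ℝ}

theorem integral_le_of_ae_le (hf : Integrable f μ) (hM : ∀ᵐ t ∂μ, f t ≤ M) : ∫ t, f t ∂μ ≤ M :=
  (integral_mono_ae hf (integrable_const M) hM).trans_eq (by simp)

theorem le_integral_of_ae_le (hf : Integrable f μ) (hM : ∀ᵐ t ∂μ, M ≤ f t) : M ≤ ∫ t, f t ∂μ :=
  (by simp : M = ∫ _, M ∂μ).trans_le (integral_mono_ae (integrable_const M) hf hM)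

end Integral

namespace IsConcaveCost

variable {c : ℝ → ℝ}

theorem monotoneOn (hc : IsConcaveCost c) : MonotoneOn c (Ici 0) :=
  monotoneOn_Ici_of_concaveOn_of_bddBelow hc.concave ⟨0, forall_mem_image.2 hc.nonneg⟩

theorem mono (hc : IsConcaveCost c) {d e : ℝ} (hd : 0 ≤ d) (hde : d ≤ e) : c d ≤ c e :=
  hc.monotoneOn hd (hd.trans hde) hde

theorem continuous_uncurry (hc : IsConcaveCost c) :
    Continuous (Function.uncurry fun s t => c |s - t|) :=
  hc.continuous.comp_continuous (continuous_fst.sub continuous_snd).abs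
    fun p => mem_Ici.2 (abs_nonneg (p.1 - p.2))

theorem continuous_abs_sub (hc : IsConcaveCost c) (s : ℝ) : Continuous fun t => c |s - t| :=
  hc.continuous_uncurry.comp (Continuous.prodMk_right s)

theorem le_two_mul_half (hc : IsConcaveCost c) {d : ℝ} (hd : 0 ≤ d) : c d ≤ 2 * c (d / 2) := by
  have h := hc.concave.2 self_mem_Ici hd one_half_pos.le one_half_pos.le (add_halves 1)
  simp only [smul_eq_mul, hc.map_zero, mul_zero, zero_add, one_div_mul_eq_div] at h
  linarith

theorem antitoneOn_abs_sub (hc : IsConcaveCost c) {v t : ℝ} (ht : v ≤ t) :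
    AntitoneOn (fun s => c |s - t|) (Iic v) := by
  intro s _ s' (hs' : s' ≤ v) hss'
  refine hc.mono (abs_nonneg _) ?_
  rw [abs_of_nonpos (by linarith), abs_of_nonpos (by linarith)]
  linarith

theorem monotoneOn_abs_sub (hc : IsConcaveCost c) {u t : ℝ} (ht : t ≤ u) :
    MonotoneOn (fun s => c |s - t|) (Ici u) := by
  intro s (hs : u ≤ s) s' _ hss'
  refine hc.mono (abs_nonneg _) ?_
  rw [abs_of_nonneg (by linarith), abs_of_nonneg (by linarith)]
  linarith

theorem concaveOn_abs_sub (hc : IsConcaveCost c) {u v t : ℝ} (ht : t ∉ Ioo u v) :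
    ConcaveOn ℝ (Icc u v) fun s => c |s - t| := by
  refine ⟨convex_Icc u v, fun p hp q hq a b ha hb hab => ?_⟩
  have hsides : 0 ≤ a * (p - t) ∧ 0 ≤ b * (q - t) ∨ a * (p - t) ≤ 0 ∧ b * (q - t) ≤ 0 := by
    rcases le_or_gt t u with htu | hut
    · exact .inl ⟨mul_nonneg ha (by linarith [hp.1]), mul_nonneg hb (by linarith [hq.1])⟩
    · have hvt : v ≤ t := not_lt.1 fun htv => ht ⟨hut, htv⟩
      exact .inr ⟨mul_nonpos_of_nonneg_of_nonpos ha (by linarith [hp.2]),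
        mul_nonpos_of_nonneg_of_nonpos hb (by linarith [hq.2])⟩
  have habs : |a • p + b • q - t| = a • |p - t| + b • |q - t| := by
    calc |a • p + b • q - t| = |a * (p - t) + b * (q - t)| := by
          simp only [smul_eq_mul]
          congr 1
          linear_combination t * hab
      _ = a • |p - t| + b • |q - t| := by
          rw [(abs_add_eq_add_abs_iff _ _).2 hsides, abs_mul, abs_mul, abs_of_nonneg ha,
            abs_of_nonneg hb, smul_eq_mul, smul_eq_mul]
  simp only [habs]
  exact hc.concave.2 (abs_nonneg (p - t)) (abs_nonneg (q - t)) ha hb hab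

end IsConcaveCost

/-- The expected cost of an agent at `s` who is served by a single random facility with law `μ`:
the potential of the kernel `c |s - t|`. -/
def singleCost (c : ℝ → ℝ) (μ : Measure ℝ) : ℝ → ℝ := potential (fun s t => c |s - t|) μ

section SingleCost

variable {c : ℝ → ℝ} {μ ν : Measure ℝ} {K L : Set ℝ}

theorem continuous_singleCost [IsLocallyFiniteMeasure μ] (hc : IsConcaveCost c) (hK : IsCompact K)
    (hμ : ∀ᵐ t ∂μ, t ∈ K) : Continuous (singleCost c μ) :=
  continuous_potential hc.continuous_uncurry hK hμ

theorem integrable_abs_sub [IsFiniteMeasureOnCompacts μ] (hc : IsConcaveCost c) (hK : IsCompact K)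
    (hμ : ∀ᵐ t ∂μ, t ∈ K) (s : ℝ) : Integrable (fun t => c |s - t|) μ :=
  integrable_of_ae_mem_isCompact hK hμ (hc.continuous_abs_sub s)

theorem antitoneOn_singleCost [IsFiniteMeasureOnCompacts μ] (hc : IsConcaveCost c)
    (hK : IsCompact K) (hμ : ∀ᵐ t ∂μ, t ∈ K) {v : ℝ} (hv : v ∈ lowerBounds K) :
    AntitoneOn (singleCost c μ) (Iic v) :=
  integral_antitoneOn_of_integrand_ae (hμ.mono fun _ ht => hc.antitoneOn_abs_sub (hv ht))
    fun s _ => integrable_abs_sub hc hK hμ s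

theorem monotoneOn_singleCost [IsFiniteMeasureOnCompacts μ] (hc : IsConcaveCost c)
    (hK : IsCompact K) (hμ : ∀ᵐ t ∂μ, t ∈ K) {u : ℝ} (hu : u ∈ upperBounds K) :
    MonotoneOn (singleCost c μ) (Ici u) :=
  integral_monotoneOn_of_integrand_ae (hμ.mono fun _ ht => hc.monotoneOn_abs_sub (hu ht))
    fun s _ => integrable_abs_sub hc hK hμ s

theorem concaveOn_singleCost [IsFiniteMeasureOnCompacts μ] (hc : IsConcaveCost c)
    (hK : IsCompact K) (hμ : ∀ᵐ t ∂μ, t ∈ K) {u v : ℝ} (huv : Disjoint K (Ioo u v)) :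
    ConcaveOn ℝ (Icc u v) (singleCost c μ) :=
  integral_concaveOn_of_integrand_ae (convex_Icc u v)
    (hμ.mono fun _ ht => hc.concaveOn_abs_sub (disjoint_left.1 huv ht))
    fun s _ => integrable_abs_sub hc hK hμ s

theorem le_singleCost_of_forall_mem [IsFiniteMeasureOnCompacts μ] [NeZero μ]
    (hc : IsConcaveCost c) (hK : IsCompact K) (hμ : ∀ᵐ t ∂μ, t ∈ K) {m : ℝ}
    (hm : ∀ a ∈ K, m ≤ singleCost c μ a) (a : ℝ) : m ≤ singleCost c μ a := by
  obtain ⟨t₀, ht₀⟩ : K.Nonempty := hμ.exists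
  rcases (K ∩ Iic a).eq_empty_or_nonempty with hleft | hleft
  · have ha : a ∈ lowerBounds K := fun t ht => le_of_not_ge fun hta => hleft.le ⟨ht, hta⟩
    obtain ⟨v, hvK, hv⟩ := hK.exists_isLeast ⟨t₀, ht₀⟩
    exact (hm v hvK).trans (antitoneOn_singleCost hc hK hμ hv (ha hvK) self_mem_Iic (ha hvK))
  rcases (K ∩ Ici a).eq_empty_or_nonempty with hright | hright
  · have ha : a ∈ upperBounds K := fun t ht => le_of_not_ge fun hat => hright.le ⟨ht, hat⟩
    obtain ⟨u, huK, hu⟩ := hK.exists_isGreatest ⟨t₀, ht₀⟩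
    exact (hm u huK).trans (monotoneOn_singleCost hc hK hμ hu self_mem_Ici (ha huK) (ha huK))
  obtain ⟨u, ⟨huK, hua⟩, hu⟩ := (hK.inter_right isClosed_Iic).exists_isGreatest hleft
  obtain ⟨v, ⟨hvK, hav⟩, hv⟩ := (hK.inter_right isClosed_Ici).exists_isLeast hright
  have hgap : Disjoint K (Ioo u v) := disjoint_left.2 fun t ht ⟨hut, htv⟩ =>
    (le_total t a).elim (fun hta => (hu ⟨ht, hta⟩).not_gt hut) fun hat => (hv ⟨ht, hat⟩).not_gt htv
  have huv : u ≤ v := le_trans hua hav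
  exact (le_min (hm u huK) (hm v hvK)).trans ((concaveOn_singleCost hc hK hμ hgap).min_le_of_mem_Icc
    (left_mem_Icc.2 huv) (right_mem_Icc.2 huv) ⟨hua, hav⟩)

theorem exists_eqOn_singleCost_const (hc : IsConcaveCost c) (hK : IsCompact K)
    (hne : K.Nonempty) : ∃ (μ : ProbabilityMeasure ℝ) (m : ℝ),
      (∀ᵐ t ∂(μ : Measure ℝ), t ∈ K) ∧ ∀ a ∈ K, singleCost c μ a = m := by
  obtain ⟨μ, m, hμ, hle, heq⟩ := exists_potential_le_and_ae_eq hc.continuous_uncurry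
    (fun s t => by rw [abs_sub_comm]) hK hne
  -- `μ` is concentrated where its potential is maximal, and elsewhere it cannot be lower.
  have hG : IsCompact (K ∩ singleCost c μ ⁻¹' {m}) :=
    hK.inter_right (isClosed_singleton.preimage (continuous_singleCost hc hK hμ))
  refine ⟨μ, m, hμ, fun a ha => (hle a ha).antisymm ?_⟩
  exact le_singleCost_of_forall_mem hc hG (hμ.and heq) (fun b hb => hb.2.ge) a

theorem integral_singleCost_sub_eq [IsFiniteMeasure μ] [IsFiniteMeasure ν] (hc : IsConcaveCost c)
    (hK : IsCompact K) (hμ : ∀ᵐ t ∂μ, t ∈ K) (hL : IsCompact L) (hν : ∀ᵐ t ∂ν, t ∈ L) (b : ℝ) :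
    ∫ s, singleCost c ν (s - b) ∂μ = ∫ t, singleCost c μ (t + b) ∂ν := by
  have hprod : ∀ᵐ p ∂μ.prod ν, p ∈ K ×ˢ L :=
    (Measure.quasiMeasurePreserving_fst.ae hμ).and (Measure.quasiMeasurePreserving_snd.ae hν)
  have hint : Integrable (fun p : ℝ × ℝ => c |p.1 - b - p.2|) (μ.prod ν) :=
    integrable_of_ae_mem_isCompact (hK.prod hL) hprod (hc.continuous_uncurry.comp
      ((continuous_fst.sub continuous_const).prodMk continuous_snd))
  calc ∫ s, singleCost c ν (s - b) ∂μ = ∫ t, ∫ s, c |s - b - t| ∂μ ∂ν :=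
        integral_integral_swap hint
    _ = ∫ t, singleCost c μ (t + b) ∂ν := by
        simp only [singleCost, potential, abs_sub_comm _ (_ : ℝ), sub_sub, add_comm]

end SingleCost

theorem exists_isEqualizing {c : ℝ → ℝ} (hc : IsConcaveCost c) {ℓ : ℝ} (hℓ : 0 ≤ ℓ) :
    ∃ μ : ProbabilityMeasure ℝ, IsEqualizing c ℓ μ := by
  obtain ⟨μ, m, hμ, hm⟩ := exists_eqOn_singleCost_const hc isCompact_Icc (nonempty_Icc.2 hℓ)
  exact ⟨μ, hμ, fun a ha b hb => (hm a ha).trans (hm b hb).symm⟩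

namespace IsEqualizing

variable {c : ℝ → ℝ} {ℓ ℓ' : ℝ} {μ ν : ProbabilityMeasure ℝ}

theorem ae_mem_Icc (h : IsEqualizing c ℓ μ) : ∀ᵐ t ∂(μ : Measure ℝ), t ∈ Icc 0 ℓ := h.support

theorem length_nonneg (h : IsEqualizing c ℓ μ) : 0 ≤ ℓ := by
  obtain ⟨t, ht⟩ := h.ae_mem_Icc.exists
  exact ht.1.trans ht.2

theorem continuous_singleCost (h : IsEqualizing c ℓ μ) (hc : IsConcaveCost c) :
    Continuous (singleCost c μ) :=
  FacilityLocation.continuous_singleCost hc isCompact_Icc h.ae_mem_Icc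

theorem integrable (h : IsEqualizing c ℓ μ) {f : ℝ → ℝ} (hf : Continuous f) :
    Integrable f (μ : Measure ℝ) :=
  integrable_of_ae_mem_isCompact isCompact_Icc h.ae_mem_Icc hf

theorem singleCost_eq (h : IsEqualizing c ℓ μ) {a : ℝ} (ha : a ∈ Icc 0 ℓ) :
    singleCost c μ a = singleCost c μ 0 :=
  h.equal a ha 0 (left_mem_Icc.2 h.length_nonneg)

theorem singleCost_zero_le (h : IsEqualizing c ℓ μ) (hc : IsConcaveCost c) (a : ℝ) :
    singleCost c μ 0 ≤ singleCost c μ a :=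
  le_singleCost_of_forall_mem hc isCompact_Icc h.ae_mem_Icc (fun _ hb => (h.singleCost_eq hb).ge) a

theorem singleCost_zero_le_half (h : IsEqualizing c ℓ μ) (hc : IsConcaveCost c) :
    singleCost c μ 0 ≤ c (ℓ / 2) := by
  have hℓ := h.length_nonneg
  rw [← h.singleCost_eq (a := ℓ / 2) ⟨by linarith, by linarith⟩]
  refine integral_le_of_ae_le (h.integrable (hc.continuous_abs_sub _)) ?_
  filter_upwards [h.ae_mem_Icc] with t ⟨ht, ht'⟩
  exact hc.mono (abs_nonneg _) (abs_le.2 ⟨by linarith, by linarith⟩)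

theorem singleCost_le_max (h : IsEqualizing c ℓ μ) (hc : IsConcaveCost c) {lo hi s : ℝ}
    (hs : s ∈ Icc lo hi) : singleCost c μ s ≤ max (singleCost c μ lo) (singleCost c μ hi) := by
  have hzero : (0 : ℝ) ∈ lowerBounds (Icc 0 ℓ) := fun _ ht => ht.1
  have hlength : ℓ ∈ upperBounds (Icc 0 ℓ) := fun _ ht => ht.2
  rcases le_total s 0 with hs0 | hs0
  · exact le_max_of_le_left
      (antitoneOn_singleCost hc isCompact_Icc h.ae_mem_Icc hzero (hs.1.trans hs0) hs0 hs.1)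
  rcases le_total s ℓ with hsℓ | hsℓ
  · rw [h.singleCost_eq ⟨hs0, hsℓ⟩]
    exact le_max_of_le_left (h.singleCost_zero_le hc lo)
  · exact le_max_of_le_right
      (monotoneOn_singleCost hc isCompact_Icc h.ae_mem_Icc hlength hsℓ (hsℓ.trans hs.2) hs.2)

-- Average the cost over independent `s` with law `μ` and `lo + t`, where `t` has law `ν`.
theorem singleCost_zero_le_max (hν : IsEqualizing c ℓ ν) (hμ : IsEqualizing c ℓ' μ)
    (hc : IsConcaveCost c) {lo hi : ℝ} (hle : ℓ ≤ hi - lo) :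
    singleCost c ν 0 ≤ max (singleCost c μ lo) (singleCost c μ hi) := by
  have hcν := hν.continuous_singleCost hc
  have hcμ := hμ.continuous_singleCost hc
  calc singleCost c ν 0 ≤ ∫ s, singleCost c ν (s - lo) ∂(μ : Measure ℝ) :=
        le_integral_of_ae_le (hμ.integrable (by fun_prop))
          (Filter.Eventually.of_forall fun s => hν.singleCost_zero_le hc (s - lo))
    _ = ∫ t, singleCost c μ (t + lo) ∂(ν : Measure ℝ) :=
        integral_singleCost_sub_eq hc isCompact_Icc hμ.ae_mem_Icc isCompact_Icc hν.ae_mem_Icc lo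
    _ ≤ max (singleCost c μ lo) (singleCost c μ hi) := by
        refine integral_le_of_ae_le (hν.integrable (by fun_prop)) ?_
        filter_upwards [hν.ae_mem_Icc] with t ⟨ht, ht'⟩
        exact hμ.singleCost_le_max hc ⟨by linarith, by linarith⟩

end IsEqualizing

variable {k n : ℕ}

/-- The intervals `[α j, α j + ℓ]` are disjoint and numbered from left to right: the part of
`IsCovering` that does not involve the agents. -/
def IsSeparated (ℓ : ℝ) (α : Fin k → ℝ) : Prop := ∀ ⦃i j⦄, i < j → α i + ℓ < α j

section Covering

variable {x : Fin n → ℝ} {ℓ : ℝ} {α : Fin k → ℝ}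

theorem IsSeparated.strictMono (h : IsSeparated ℓ α) (hℓ : 0 ≤ ℓ) : StrictMono α :=
  fun _ _ hij => (le_add_of_nonneg_right hℓ).trans_lt (h hij)

theorem IsSeparated.cons (h : IsSeparated ℓ α) {m : ℝ} (hm : ∀ j, m + ℓ < α j) :
    IsSeparated ℓ (Fin.cons m α : Fin (k + 1) → ℝ) := by
  intro i j hij
  obtain ⟨j, rfl⟩ := Fin.exists_succ_eq.2 (Fin.ne_zero_of_lt hij)
  cases i using Fin.cases with
  | zero => exact hm j
  | succ i => exact h (Fin.succ_lt_succ_iff.1 hij)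

theorem IsSeparated.isCovering (h : IsSeparated ℓ α) (hℓ : 0 ≤ ℓ)
    (hx : ∀ i, ∃ j, x i ∈ Icc (α j) (α j + ℓ)) : IsCovering x ℓ α where
  length_nonneg := hℓ
  strictMono := h.strictMono hℓ
  disjoint := (pairwise_disjoint_on _).2 fun _ _ hij =>
    disjoint_left.2 fun _ hi hj => (hi.2.trans_lt (h hij)).not_ge hj.1
  covers := hx

theorem IsCovering.isSeparated (h : IsCovering x ℓ α) : IsSeparated ℓ α := by
  intro i j hij
  by_contra! hle
  exact disjoint_left.1 (h.disjoint hij.ne) ⟨(h.strictMono hij).le, hle⟩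
    (left_mem_Icc.2 (le_add_of_nonneg_right h.length_nonneg))

theorem exists_le_and_interval_le_add {ι : Type*} [Nonempty ι] {T : Finset ℝ} {b : ℝ}
    (hb : ∀ t ∈ T, b < t) {β : ι → ℝ} (hβ : ∀ t ∈ T, ∃ j, t ∈ Icc (β j) (β j + ℓ)) :
    ∃ m, b < m ∧ (∀ t ∈ T, m ≤ t) ∧ ∃ j, ∀ t ∈ T, t ∈ Icc (β j) (β j + ℓ) → t ≤ m + ℓ := by
  rcases T.eq_empty_or_nonempty with rfl | hT
  · exact ⟨b + 1, lt_add_one b, by simp, Classical.arbitrary ι, by simp⟩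
  · obtain ⟨j, hj⟩ := hβ _ (T.min'_mem hT)
    exact ⟨T.min' hT, hb _ (T.min'_mem hT), T.min'_le, j, fun t _ ht => by linarith [ht.2, hj.1]⟩

theorem exists_isSeparated_cover (k : ℕ) (hℓ : 0 ≤ ℓ) (T : Finset ℝ) {b : ℝ} (hb : ∀ t ∈ T, b < t)
    {β : Fin k → ℝ} (hβ : ∀ t ∈ T, ∃ j, t ∈ Icc (β j) (β j + ℓ)) :
    ∃ α : Fin k → ℝ, (∀ j, b < α j) ∧ IsSeparated ℓ α ∧ ∀ t ∈ T, ∃ j, t ∈ Icc (α j) (α j + ℓ) := by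
  induction k generalizing T b with
  | zero => exact ⟨β, fun j => j.elim0, fun i => i.elim0, hβ⟩
  | succ k ih =>
    obtain ⟨m, hbm, hmin, j₀, hj₀⟩ := exists_le_and_interval_le_add hb hβ
    -- The first interval starts at `m` and makes the `j₀`-th of the given intervals superfluous.
    have hrest : ∀ t ∈ T.filter (m + ℓ < ·),
        ∃ j, t ∈ Icc (β (j₀.succAbove j)) (β (j₀.succAbove j) + ℓ) := fun t ht => by
      obtain ⟨htT, hmt⟩ := Finset.mem_filter.1 ht
      obtain ⟨j, hj⟩ := hβ t htT
      obtain ⟨i, rfl⟩ := Fin.exists_succAbove_eq (x := j) (y := j₀) <| by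
        rintro rfl
        exact (hj₀ t htT hj).not_gt hmt
      exact ⟨i, hj⟩
    obtain ⟨α, hmα, hsep, hα⟩ := ih (T.filter (m + ℓ < ·)) (fun t ht => (Finset.mem_filter.1 ht).2)
      hrest
    refine ⟨Fin.cons m α, fun j => ?_, hsep.cons hmα, fun t ht => ?_⟩
    · cases j using Fin.cases with
      | zero => exact hbm
      | succ j =>
        rw [Fin.cons_succ]
        linarith [hmα j]
    · rcases le_or_gt t (m + ℓ) with htm | hmt
      · exact ⟨0, hmin t ht, htm⟩
      · obtain ⟨j, hj⟩ := hα t (Finset.mem_filter.2 ⟨ht, hmt⟩)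
        exact ⟨j.succ, hj⟩

theorem exists_isCovering (hℓ : 0 ≤ ℓ) {β : Fin k → ℝ}
    (hβ : ∀ i, ∃ j, x i ∈ Icc (β j) (β j + ℓ)) : ∃ α : Fin k → ℝ, IsCovering x ℓ α := by
  obtain ⟨b, hb⟩ := (Finset.univ.image x).bddBelow
  obtain ⟨α, -, hsep, hα⟩ := exists_isSeparated_cover k hℓ (Finset.univ.image x)
    (fun t ht => (sub_one_lt b).trans_le (hb ht)) (by simpa using hβ)
  exact ⟨α, hsep.isCovering hℓ (by simpa using hα)⟩

theorem IsMinLength.le_of_cover (h : IsMinLength k x ℓ) {L : ℝ} (hL : 0 ≤ L) {β : Fin k → ℝ}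
    (hβ : ∀ i, ∃ j, x i ∈ Icc (β j) (β j + L)) : ℓ ≤ L :=
  h.2 (exists_isCovering hL hβ)

/-- The largest distance between two agents in the same part of the partition of the agents into
the fibers of `f`. The minimum length of a covering is the least value over all `f`. -/
def clusterDiam (x : Fin n → ℝ) (f : Fin n → Fin k) : ℝ :=
  ⨆ p : {p : Fin n × Fin n // f p.1 = f p.2}, |x p.1.1 - x p.1.2|

theorem clusterDiam_nonneg (x : Fin n → ℝ) (f : Fin n → Fin k) : 0 ≤ clusterDiam x f :=
  Real.iSup_nonneg fun _ => abs_nonneg _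

theorem exists_isCovering_clusterDiam (x : Fin n → ℝ) (f : Fin n → Fin k) :
    ∃ α : Fin k → ℝ, IsCovering x (clusterDiam x f) α := by
  refine exists_isCovering (clusterDiam_nonneg x f) (β := fun j => sInf (x '' (f ⁻¹' {j})))
    fun i => ⟨f i, csInf_le (toFinite _).bddBelow (mem_image_of_mem x rfl), ?_⟩
  rw [← sub_le_iff_le_add]
  refine le_csInf ⟨x i, mem_image_of_mem x rfl⟩ (forall_mem_image.2 fun i' hi' => ?_)
  have hdiam : |x i - x i'| ≤ clusterDiam x f :=
    le_ciSup (f := fun p : {p : Fin n × Fin n // f p.1 = f p.2} => |x p.1.1 - x p.1.2|)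
      (finite_range _).bddAbove ⟨(i, i'), hi'.symm⟩
  linarith [le_abs_self (x i - x i')]

theorem IsCovering.exists_clusterDiam_le (h : IsCovering x ℓ α) :
    ∃ f : Fin n → Fin k, clusterDiam x f ≤ ℓ := by
  choose f hf using h.covers
  refine ⟨f, Real.iSup_le (fun ⟨⟨i, i'⟩, hii'⟩ => ?_) h.length_nonneg⟩
  have hi := hf i
  rw [hii'] at hi
  exact (abs_sub_le_of_le_of_le hi.1 hi.2 (hf i').1 (hf i').2).trans_eq (add_sub_cancel_left _ _)

theorem exists_isMinLength [NeZero k] (x : Fin n → ℝ) : ∃ ℓ, IsMinLength k x ℓ := by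
  obtain ⟨f, hf⟩ := Finite.exists_min (clusterDiam (k := k) x)
  refine ⟨clusterDiam x f, exists_isCovering_clusterDiam x f, fun ℓ ⟨α, hα⟩ => ?_⟩
  obtain ⟨g, hg⟩ := hα.exists_clusterDiam_le
  exact (hf g).trans hg

end Covering

/-- No member of the family `y` is nearer to `a` than `y j`: an agent at `a` may use
facility `j`. -/
def IsNearest {ι : Type*} (y : ι → ℝ) (a : ℝ) (j : ι) : Prop := ∀ i, |a - y j| ≤ |a - y i|

section Nearest

variable {ι : Type*} {y z : ι → ℝ} {a : ℝ} {j : ι}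

theorem exists_isNearest [Finite ι] [Nonempty ι] (y : ι → ℝ) (a : ℝ) : ∃ j, IsNearest y a j :=
  Finite.exists_min fun j => |a - y j|

theorem IsNearest.iInf_abs_sub_eq [Finite ι] (h : IsNearest y a j) : ⨅ i, |a - y i| = |a - y j| :=
  have : Nonempty ι := ⟨j⟩
  le_antisymm (ciInf_le (finite_range _).bddBelow j) (le_ciInf h)

theorem abs_sub_left_le_iff_of_lt {p q : ℝ} (h : p < q) : |a - p| ≤ |a - q| ↔ 2 * a ≤ p + q := by
  rw [← sq_le_sq, ← sub_nonneg,
    show (a - q) ^ 2 - (a - p) ^ 2 = (q - p) * (p + q - 2 * a) by ring,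
    mul_nonneg_iff_of_pos_left (sub_pos.2 h), sub_nonneg]

theorem abs_sub_right_le_iff_of_lt {p q : ℝ} (h : p < q) : |a - q| ≤ |a - p| ↔ p + q ≤ 2 * a := by
  rw [← sq_le_sq, ← sub_nonneg,
    show (a - p) ^ 2 - (a - q) ^ 2 = (q - p) * (2 * a - (p + q)) by ring,
    mul_nonneg_iff_of_pos_left (sub_pos.2 h), sub_nonneg]

variable [LinearOrder ι] [IsStronglyAtomic ι] [IsStronglyCoatomic ι]

theorem isNearest_iff_of_strictMono (hy : StrictMono y) :
    IsNearest y a j ↔ (∀ i, i ⋖ j → y i + y j ≤ 2 * a) ∧ ∀ i, j ⋖ i → 2 * a ≤ y j + y i := by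
  refine ⟨fun h => ⟨fun i hi => (abs_sub_right_le_iff_of_lt (hy hi.lt)).1 (h i),
    fun i hi => (abs_sub_left_le_iff_of_lt (hy hi.lt)).1 (h i)⟩, fun ⟨hleft, hright⟩ m => ?_⟩
  rcases lt_trichotomy m j with hmj | rfl | hjm
  · obtain ⟨i, hmi, hij⟩ := exists_le_covBy_of_lt hmj
    exact (abs_sub_right_le_iff_of_lt (hy hmj)).2
      ((add_le_add_left (hy.monotone hmi) _).trans (hleft i hij))
  · exact le_rfl
  · obtain ⟨i, hji, him⟩ := exists_covBy_le_of_lt hjm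
    exact (abs_sub_left_le_iff_of_lt (hy hjm)).2
      ((hright i hji).trans (add_le_add_right (hy.monotone him) _))

theorem isNearest_congr_of_strictMono (hy : StrictMono y) (hz : StrictMono z)
    (h : ∀ i j, i ⋖ j → y i + y j = z i + z j) : IsNearest y a j ↔ IsNearest z a j := by
  rw [isNearest_iff_of_strictMono hy, isNearest_iff_of_strictMono hz]
  refine and_congr (forall₂_congr fun i hi => ?_) (forall₂_congr fun i hi => ?_) <;> rw [h _ _ hi]

end Nearest

/-- The coordinate of `a` in the `j`-th interval, measured from the endpoint from which
`placement` measures its sample; `placement ℓ α t j` is the point with coordinate `t`. -/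
def foldCoord (ℓ : ℝ) (α : Fin k → ℝ) (j : Fin k) (a : ℝ) : ℝ :=
  if Even (j : ℕ) then a - α j else α j + ℓ - a

section Placement

variable {ℓ t t' : ℝ} {α : Fin k → ℝ}

theorem continuous_placement (ℓ : ℝ) (α : Fin k → ℝ) : Continuous (placement ℓ α) := by
  refine continuous_pi fun j => ?_
  unfold placement
  split_ifs <;> fun_prop

theorem placement_mem_Icc (ht : t ∈ Icc 0 ℓ) (α : Fin k → ℝ) (j : Fin k) :
    placement ℓ α t j ∈ Icc (α j) (α j + ℓ) := by
  obtain ⟨h₀, hℓ⟩ := ht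
  unfold placement
  split_ifs <;> constructor <;> linarith

theorem IsSeparated.strictMono_placement (h : IsSeparated ℓ α) (ht : t ∈ Icc 0 ℓ) :
    StrictMono (placement ℓ α t) := fun i j hij =>
  ((placement_mem_Icc ht α i).2.trans_lt (h hij)).trans_le (placement_mem_Icc ht α j).1

theorem placement_add_placement_of_covBy (ℓ : ℝ) (α : Fin k → ℝ) (t : ℝ) {i j : Fin k}
    (h : i ⋖ j) : placement ℓ α t i + placement ℓ α t j = α i + α j + ℓ := by
  have hij : (i : ℕ) + 1 = j := Nat.covBy_iff_add_one_eq.1 (Fin.covBy_iff.1 h)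
  simp only [placement, ← hij, Nat.even_add_one]
  split_ifs <;> ring

/-- Consecutive facilities move in opposite directions, so the point halfway between them, where
the nearest facility changes, does not depend on the sample. -/
theorem IsSeparated.isNearest_placement_iff (h : IsSeparated ℓ α) (ht : t ∈ Icc 0 ℓ)
    (ht' : t' ∈ Icc 0 ℓ) {a : ℝ} {j : Fin k} :
    IsNearest (placement ℓ α t) a j ↔ IsNearest (placement ℓ α t') a j :=
  isNearest_congr_of_strictMono (h.strictMono_placement ht) (h.strictMono_placement ht')
    fun i j hij => by simp only [placement_add_placement_of_covBy ℓ α _ hij]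

theorem abs_sub_placement (ℓ : ℝ) (α : Fin k → ℝ) (t : ℝ) (j : Fin k) (a : ℝ) :
    |a - placement ℓ α t j| = |foldCoord ℓ α j a - t| := by
  unfold placement foldCoord
  split_ifs
  · congr 1; ring
  · rw [abs_sub_comm]; congr 1; ring

theorem foldCoord_mem_Icc_iff {lo hi a : ℝ} {j : Fin k} :
    foldCoord ℓ α j a ∈ Icc lo hi ↔
      a ∈ Icc (if Even (j : ℕ) then α j + lo else α j + ℓ - hi)
        ((if Even (j : ℕ) then α j + lo else α j + ℓ - hi) + (hi - lo)) := by
  unfold foldCoord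
  split_ifs <;> constructor <;> rintro ⟨h₁, h₂⟩ <;> constructor <;> linarith

theorem foldCoord_mem_Icc_zero_iff {a : ℝ} {j : Fin k} :
    foldCoord ℓ α j a ∈ Icc 0 ℓ ↔ a ∈ Icc (α j) (α j + ℓ) := by
  rw [foldCoord_mem_Icc_iff]
  simp

theorem abs_sub_placement_half_le_iff {a : ℝ} {j : Fin k} :
    |a - placement ℓ α (ℓ / 2) j| ≤ ℓ / 2 ↔ a ∈ Icc (α j) (α j + ℓ) := by
  rw [← foldCoord_mem_Icc_zero_iff, abs_sub_placement, abs_sub_comm, mem_Icc_iff_abs_le, sub_self,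
    add_halves]

theorem IsSeparated.mem_Icc_of_isNearest_placement (h : IsSeparated ℓ α) (ht : t ∈ Icc 0 ℓ)
    {a : ℝ} {i j : Fin k} (hj : IsNearest (placement ℓ α t) a j) (hi : a ∈ Icc (α i) (α i + ℓ)) :
    a ∈ Icc (α j) (α j + ℓ) := by
  have hhalf : ℓ / 2 ∈ Icc 0 ℓ := by constructor <;> linarith [ht.1, ht.2]
  exact abs_sub_placement_half_le_iff.1
    (((h.isNearest_placement_iff ht hhalf).1 hj i).trans (abs_sub_placement_half_le_iff.2 hi))

theorem abs_sub_placement_le {a : ℝ} {j : Fin k} (ht : t ∈ Icc 0 ℓ)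
    (ha : a ∈ Icc (α j) (α j + ℓ)) : |a - placement ℓ α t j| ≤ ℓ := by
  simpa using abs_sub_le_of_le_of_le ha.1 ha.2 (placement_mem_Icc ht α j).1
    (placement_mem_Icc ht α j).2

end Placement

section Costs

variable {c : ℝ → ℝ} {x : Fin n → ℝ} {ℓ : ℝ}

theorem continuous_iInf_of_finite {ι X : Type*} [Finite ι] [TopologicalSpace X] {f : ι → X → ℝ}
    (hf : ∀ i, Continuous (f i)) : Continuous fun p => ⨅ i, f i p := by
  have := Fintype.ofFinite ι
  cases isEmpty_or_nonempty ι
  · simpa only [Real.iInf_of_isEmpty] using continuous_const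
  · simp_rw [← Finset.inf'_univ_eq_ciInf]
    exact Continuous.finset_inf'_apply _ fun i _ => hf i

theorem continuous_iSup_of_finite {ι X : Type*} [Finite ι] [TopologicalSpace X] {f : ι → X → ℝ}
    (hf : ∀ i, Continuous (f i)) : Continuous fun p => ⨆ i, f i p := by
  have := Fintype.ofFinite ι
  cases isEmpty_or_nonempty ι
  · simpa only [Real.iSup_of_isEmpty] using continuous_const
  · simp_rw [← Finset.sup'_univ_eq_ciSup]
    exact Continuous.finset_sup'_apply _ fun i _ => hf i

theorem cost_nonneg (hc : IsConcaveCost c) (a : ℝ) (y : Fin k → ℝ) : 0 ≤ cost c a y :=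
  hc.nonneg _ (Real.iInf_nonneg fun _ => abs_nonneg _)

theorem cost_le_of_abs_le (hc : IsConcaveCost c) {a d : ℝ} {y : Fin k → ℝ} {j : Fin k}
    (h : |a - y j| ≤ d) : cost c a y ≤ c d :=
  hc.mono (Real.iInf_nonneg fun _ => abs_nonneg _)
    ((ciInf_le (finite_range _).bddBelow j).trans h)

theorem continuous_cost (hc : IsConcaveCost c) (a : ℝ) :
    Continuous fun y : Fin k → ℝ => cost c a y :=
  hc.continuous.comp_continuous (continuous_iInf_of_finite fun j => by fun_prop)
    fun _ => Real.iInf_nonneg fun _ => abs_nonneg _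

theorem continuous_maxCost (hc : IsConcaveCost c) (x : Fin n → ℝ) :
    Continuous fun y : Fin k → ℝ => maxCost c x y :=
  continuous_iSup_of_finite fun i => continuous_cost hc (x i)

theorem cost_le_maxCost (c : ℝ → ℝ) (x : Fin n → ℝ) (y : Fin k → ℝ) (i : Fin n) :
    cost c (x i) y ≤ maxCost c x y :=
  le_ciSup (f := fun i => cost c (x i) y) (finite_range _).bddAbove i

theorem bddBelow_range_maxCost (hc : IsConcaveCost c) (k : ℕ) (x : Fin n → ℝ) :
    BddBelow (range fun y : Fin k → ℝ => maxCost c x y) :=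
  ⟨0, forall_mem_range.2 fun _ => Real.iSup_nonneg fun _ => cost_nonneg hc _ _⟩

theorem IsCovering.maxCost_placement_le {α : Fin k → ℝ} (hα : IsCovering x ℓ α)
    (hc : IsConcaveCost c) {t : ℝ} (ht : t ∈ Icc 0 ℓ) : maxCost c x (placement ℓ α t) ≤ c ℓ :=
  Real.iSup_le (fun i =>
    have ⟨_, hj⟩ := hα.covers i
    cost_le_of_abs_le hc (abs_sub_placement_le ht hj)) (hc.nonneg _ hα.length_nonneg)

theorem IsCovering.optMaxCost_le {α : Fin k → ℝ} (hα : IsCovering x ℓ α) (hc : IsConcaveCost c) :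
    optMaxCost k c x ≤ c (ℓ / 2) := by
  refine (ciInf_le (bddBelow_range_maxCost hc k x) (placement ℓ α (ℓ / 2))).trans <|
    Real.iSup_le (fun i => ?_) (hc.nonneg _ (div_nonneg hα.length_nonneg zero_le_two))
  obtain ⟨j, hj⟩ := hα.covers i
  exact cost_le_of_abs_le hc (abs_sub_placement_half_le_iff.2 hj)

theorem IsMinLength.cost_half_le_maxCost [NeZero n] [NeZero k] (h : IsMinLength k x ℓ)
    (hc : IsConcaveCost c) (y : Fin k → ℝ) : c (ℓ / 2) ≤ maxCost c x y := by
  obtain ⟨α, hα⟩ := h.1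
  obtain ⟨i₀, hi₀⟩ := Finite.exists_max fun i => ⨅ j, |x i - y j|
  set r := ⨅ j, |x i₀ - y j|
  have hr₀ : 0 ≤ r := Real.iInf_nonneg fun _ => abs_nonneg _
  have hle : ℓ ≤ 2 * r := h.le_of_cover (by positivity) (β := fun j => y j - r) fun i => by
    obtain ⟨j, hj⟩ := exists_isNearest y (x i)
    have hij := abs_le.1 (hj.iInf_abs_sub_eq.symm.trans_le (hi₀ i))
    exact ⟨j, by linarith [hij.1], by linarith [hij.2]⟩
  calc c (ℓ / 2) ≤ c r := hc.mono (div_nonneg hα.length_nonneg zero_le_two) (by linarith)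
    _ ≤ maxCost c x y := cost_le_maxCost c x y i₀

theorem IsMinLength.optMaxCost_eq [NeZero n] [NeZero k] (h : IsMinLength k x ℓ)
    (hc : IsConcaveCost c) : optMaxCost k c x = c (ℓ / 2) := by
  obtain ⟨α, hα⟩ := h.1
  exact (hα.optMaxCost_le hc).antisymm (le_ciInf (h.cost_half_le_maxCost hc))

theorem optMaxCost_le_optSocialCost (hc : IsConcaveCost c) (k : ℕ) (x : Fin n → ℝ) :
    optMaxCost k c x ≤ optSocialCost k c x :=
  ciInf_mono (bddBelow_range_maxCost hc k x) fun y =>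
    Real.iSup_le (fun i => Finset.single_le_sum (f := fun i => cost c (x i) y)
      (fun _ _ => cost_nonneg hc _ _) (Finset.mem_univ i))
      (Finset.sum_nonneg fun _ _ => cost_nonneg hc _ _)

end Costs

/-- The law of the facilities of the Equal Cost mechanism for the covering `α` by intervals of
length `ℓ` and a random variable with law `μ`. -/
def facilityLaw (ℓ : ℝ) (α : Fin k → ℝ) (μ : ProbabilityMeasure ℝ) :
    ProbabilityMeasure (Fin k → ℝ) :=
  μ.map (continuous_placement ℓ α).aemeasurable

section FacilityLaw

variable {c : ℝ → ℝ} {x : Fin n → ℝ} {ℓ : ℝ} {α : Fin k → ℝ} {μ : ProbabilityMeasure ℝ}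

theorem integral_facilityLaw (ℓ : ℝ) (α : Fin k → ℝ) (μ : ProbabilityMeasure ℝ)
    {f : (Fin k → ℝ) → ℝ} (hf : Continuous f) :
    ∫ y, f y ∂(facilityLaw ℓ α μ : Measure (Fin k → ℝ)) =
      ∫ t, f (placement ℓ α t) ∂(μ : Measure ℝ) :=
  integral_map (continuous_placement ℓ α).aemeasurable hf.aestronglyMeasurable

theorem expMaxCost_facilityLaw_le (hc : IsConcaveCost c) (hα : IsCovering x ℓ α)
    (hμ : IsEqualizing c ℓ μ) : expMaxCost c x (facilityLaw ℓ α μ) ≤ c ℓ := by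
  rw [expMaxCost, integral_facilityLaw ℓ α μ (continuous_maxCost hc x)]
  exact integral_le_of_ae_le
    (hμ.integrable ((continuous_maxCost hc x).comp (continuous_placement ℓ α)))
    (hμ.ae_mem_Icc.mono fun _ => hα.maxCost_placement_le hc)

theorem expCost_facilityLaw (hc : IsConcaveCost c) (hα : IsSeparated ℓ α)
    (hμ : IsEqualizing c ℓ μ) {t a : ℝ} (ht : t ∈ Icc 0 ℓ) {j : Fin k}
    (hj : IsNearest (placement ℓ α t) a j) :
    expCost c a (facilityLaw ℓ α μ) = singleCost c μ (foldCoord ℓ α j a) := by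
  rw [expCost, integral_facilityLaw ℓ α μ (continuous_cost hc a)]
  refine integral_congr_ae (hμ.ae_mem_Icc.mono fun t' ht' => ?_)
  dsimp only [cost]
  rw [((hα.isNearest_placement_iff ht ht').1 hj).iInf_abs_sub_eq, abs_sub_placement]

theorem exists_expCost_facilityLaw_eq [NeZero k] (hc : IsConcaveCost c) (hα : IsSeparated ℓ α)
    (hμ : IsEqualizing c ℓ μ) (a : ℝ) :
    ∃ j, expCost c a (facilityLaw ℓ α μ) = singleCost c μ (foldCoord ℓ α j a) :=
  have ⟨j, hj⟩ := exists_isNearest (placement ℓ α 0) a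
  ⟨j, expCost_facilityLaw hc hα hμ (left_mem_Icc.2 hμ.length_nonneg) hj⟩

theorem singleCost_zero_le_expCost [NeZero k] (hc : IsConcaveCost c) (hα : IsSeparated ℓ α)
    (hμ : IsEqualizing c ℓ μ) (a : ℝ) :
    singleCost c μ 0 ≤ expCost c a (facilityLaw ℓ α μ) := by
  obtain ⟨j, hj⟩ := exists_expCost_facilityLaw_eq hc hα hμ a
  exact hj ▸ hμ.singleCost_zero_le hc _

theorem expCost_eq_singleCost_zero (hc : IsConcaveCost c) (hα : IsCovering x ℓ α)
    (hμ : IsEqualizing c ℓ μ) (i : Fin n) :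
    expCost c (x i) (facilityLaw ℓ α μ) = singleCost c μ 0 := by
  obtain ⟨m, hm⟩ := hα.covers i
  have : Nonempty (Fin k) := ⟨m⟩
  obtain ⟨j, hj⟩ := exists_isNearest (placement ℓ α 0) (x i)
  have h₀ : 0 ∈ Icc 0 ℓ := left_mem_Icc.2 hμ.length_nonneg
  rw [expCost_facilityLaw hc hα.isSeparated hμ h₀ hj, hμ.singleCost_eq]
  exact foldCoord_mem_Icc_zero_iff.2 (hα.isSeparated.mem_Icc_of_isNearest_placement h₀ hj hm)

/-- By minimality of `ℓ`, the coordinates of the agents in the intervals serving them spread over a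
range of length at least `ℓ`; one of the two agents at its ends is as required. -/
theorem IsMinLength.exists_singleCost_zero_le_expCost [NeZero n] [NeZero k] (h : IsMinLength k x ℓ)
    (hc : IsConcaveCost c) {ν : ProbabilityMeasure ℝ} (hν : IsEqualizing c ℓ ν) {ℓ' : ℝ}
    {α' : Fin k → ℝ} (hα' : IsSeparated ℓ' α') (hμ : IsEqualizing c ℓ' μ) :
    ∃ i, singleCost c ν 0 ≤ expCost c (x i) (facilityLaw ℓ' α' μ) := by
  choose J hJ using fun i => exists_expCost_facilityLaw_eq hc hα' hμ (x i)
  simp only [hJ]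
  obtain ⟨i₀, hi₀⟩ := Finite.exists_min fun i => foldCoord ℓ' α' (J i) (x i)
  obtain ⟨i₁, hi₁⟩ := Finite.exists_max fun i => foldCoord ℓ' α' (J i) (x i)
  set lo := foldCoord ℓ' α' (J i₀) (x i₀)
  set hi := foldCoord ℓ' α' (J i₁) (x i₁)
  have hℓ : ℓ ≤ hi - lo := h.le_of_cover (sub_nonneg.2 (hi₀ i₁))
    (β := fun j => if Even (j : ℕ) then α' j + lo else α' j + ℓ' - hi)
    fun i => ⟨J i, foldCoord_mem_Icc_iff.1 ⟨hi₀ i, hi₁ i⟩⟩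
  exact (le_max_iff.1 (hν.singleCost_zero_le_max hμ hc hℓ)).elim (⟨i₀, ·⟩) (⟨i₁, ·⟩)

end FacilityLaw

section EqualCost

theorem exists_isEqualCost [NeZero k] : ∃ F : Mechanism k n, IsEqualCost F := by
  have hP : ∀ (x : Fin n → ℝ) (c : ℝ → ℝ), ∃ P : ProbabilityMeasure (Fin k → ℝ),
      c ∈ concaveCosts → ∃ (ℓ : ℝ) (α : Fin k → ℝ) (μ : ProbabilityMeasure ℝ),
        IsMinLength k x ℓ ∧ IsCovering x ℓ α ∧ IsEqualizing c ℓ μ ∧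
          (P : Measure (Fin k → ℝ)) = (μ : Measure ℝ).map (placement ℓ α) := by
    intro x c
    by_cases hc : c ∈ concaveCosts
    · obtain ⟨ℓ, hℓ⟩ := exists_isMinLength (k := k) x
      obtain ⟨α, hα⟩ := hℓ.1
      obtain ⟨μ, hμ⟩ := exists_isEqualizing hc hα.length_nonneg
      exact ⟨facilityLaw ℓ α μ, fun _ => ⟨ℓ, α, μ, hℓ, hα, hμ, rfl⟩⟩
    · exact ⟨⟨Measure.dirac 0, inferInstance⟩, fun h => absurd h hc⟩
  choose F hF using hP
  exact ⟨F, fun c hc x => hF x c hc⟩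

namespace IsEqualCost

variable {F : Mechanism k n} {c : ℝ → ℝ}

theorem exists_eq_facilityLaw (hF : IsEqualCost F) (hc : IsConcaveCost c) (x : Fin n → ℝ) :
    ∃ ℓ α μ, IsMinLength k x ℓ ∧ IsCovering x ℓ α ∧ IsEqualizing c ℓ μ ∧
      F x c = facilityLaw ℓ α μ :=
  have ⟨ℓ, α, μ, hℓ, hα, hμ, hP⟩ := hF c hc x
  ⟨ℓ, α, μ, hℓ, hα, hμ, Subtype.ext hP⟩

theorem expCost_le_optMaxCost [NeZero n] [NeZero k] (hF : IsEqualCost F) (hc : IsConcaveCost c)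
    (x : Fin n → ℝ) (i : Fin n) : expCost c (x i) (F x c) ≤ optMaxCost k c x := by
  obtain ⟨ℓ, α, μ, hℓ, hα, hμ, hP⟩ := hF.exists_eq_facilityLaw hc x
  rw [hP, expCost_eq_singleCost_zero hc hα hμ, hℓ.optMaxCost_eq hc]
  exact hμ.singleCost_zero_le_half hc

theorem hasSocialCostRatio [NeZero n] [NeZero k] (hF : IsEqualCost F) :
    HasSocialCostRatio concaveCosts F n := fun c hc x =>
  calc expSocialCost c x (F x c) ≤ ∑ _i : Fin n, optSocialCost k c x :=
        Finset.sum_le_sum fun i _ =>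
          (hF.expCost_le_optMaxCost hc x i).trans (optMaxCost_le_optSocialCost hc k x)
    _ = n * optSocialCost k c x := by simp

theorem hasMaxCostRatio [NeZero n] [NeZero k] (hF : IsEqualCost F) :
    HasMaxCostRatio concaveCosts F 2 := fun c hc x => by
  obtain ⟨ℓ, α, μ, hℓ, hα, hμ, hP⟩ := hF.exists_eq_facilityLaw hc x
  calc expMaxCost c x (F x c) ≤ c ℓ := hP ▸ expMaxCost_facilityLaw_le hc hα hμ
    _ ≤ 2 * c (ℓ / 2) := IsConcaveCost.le_two_mul_half hc hα.length_nonneg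
    _ = 2 * optMaxCost k c x := by rw [hℓ.optMaxCost_eq hc]

theorem groupStrategyproof [NeZero n] [NeZero k] (hF : IsEqualCost F) :
    GroupStrategyproof concaveCosts F := fun c hc x S ⟨i₀, hi₀⟩ x' hx' => by
  obtain ⟨ℓ, α, ν, hℓ, hα, hν, hP⟩ := hF.exists_eq_facilityLaw hc x
  obtain ⟨ℓ', α', μ, -, hα', hμ, hP'⟩ := hF.exists_eq_facilityLaw hc x'
  simp only [hP, hP', expCost_eq_singleCost_zero hc hα hν]
  obtain ⟨i, hi⟩ := hℓ.exists_singleCost_zero_le_expCost hc hν hα'.isSeparated hμ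
  by_cases hiS : i ∈ S
  · exact ⟨i, hiS, hi⟩
  · refine ⟨i₀, hi₀, hi.trans ?_⟩
    rw [← hx' i hiS, expCost_eq_singleCost_zero hc hα' hμ]
    exact singleCost_zero_le_expCost hc hα'.isSeparated hμ (x i₀)

end IsEqualCost

end EqualCost

end FacilityLocation

end

theorem theorem1 (k n : ℕ) (hk : 1 ≤ k) (hn : k + 1 ≤ n) :
    (∃ F : FacilityLocation.Mechanism k n, FacilityLocation.IsEqualCost F) ∧
    (∀ F : FacilityLocation.Mechanism k n, FacilityLocation.IsEqualCost F →
      FacilityLocation.GroupStrategyproof FacilityLocation.concaveCosts F ∧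
      FacilityLocation.HasMaxCostRatio FacilityLocation.concaveCosts F 2 ∧
      FacilityLocation.HasSocialCostRatio FacilityLocation.concaveCosts F (n : ℝ) ∧
      ∀ c ∈ FacilityLocation.concaveCosts, ∀ (x : Fin n → ℝ) (i : Fin n),
        FacilityLocation.expCost c (x i) (F x c) ≤ FacilityLocation.optMaxCost k c x) ∧
    (∀ c ∈ FacilityLocation.concaveCosts, ∀ (x : Fin n → ℝ) (ℓ : ℝ),
      FacilityLocation.IsMinLength k x ℓ →
        FacilityLocation.optMaxCost k c x = c (ℓ / 2)) := by
  have : NeZero k := ⟨by omega⟩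
  have : NeZero n := ⟨by omega⟩
  exact ⟨FacilityLocation.exists_isEqualCost,
    fun F hF => ⟨hF.groupStrategyproof, hF.hasMaxCostRatio, hF.hasSocialCostRatio,
      fun c hc x i => hF.expCost_le_optMaxCost hc x i⟩,
    fun c hc x ℓ hℓ => hℓ.optMaxCost_eq hc⟩
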